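/- Let $H$ be a complex Hilbert space of finite dimension $D\ge 1$. A $\dagger$-SCFA ($\dagger$-special commutative Frobenius algebra) on $H$ consists of linear maps $\mu:H\otimes H\to H$, $\eta:\mathbb C\to H$, $\delta:H\to H\otimes H$, $\epsilon:H\to\mathbb C$ such that $(\mu,\eta)$ is a commutative monoid, $(\delta,\epsilon)$ is a comonoid, the Frobenius identity $(\mu\otimes 1)(1\otimes\delta)=\delta\mu=(1\otimes\mu)(\delta\otimes 1)$ holds, $\mu=\delta^\dagger$, $\eta=\epsilon^\dagger$ and $\mu\delta=1_H$. A pair $(O,O')$ of $\dagger$-SCFAs on $H$ is strongly complementary if, with $s:=\epsilon_O\circ\eta_{O'}\in\mathbb C$ and $\sigma$ the swap, the scaled bialgebra equations hold: $$\delta_O\,\mu_{O'}=s\,(\mu_{O'}\otimes\mu_{O'})(1\otimes\sigma\otimes1)(\delta_O\otimes\delta_O),\qquad s\,\delta_O\,\eta_{O'}=\eta_{O'}\otimes\eta_{O'},\qquad s\,\epsilon_O\,\mu_{O'}=\epsilon_O\otimes\epsilon_O .$$ The pair is normalised if moreover $s=\sqrt D$. For an Abelian group $G$ of order $D$, an orthonormal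 basis $\{|g\rangle:g\in G\}$ of $H$ and $\omega\in\mathbb C$ with $|\omega|=1$, say that $(O,O')$ has the form $(G,\{|g\rangle\},\omega)$ if for all $g,h\in G$ (with $e$ the identity of $G$) $$\delta_O|g\rangle=|g\rangle\otimes|g\rangle,\quad \epsilon_O|g\rangle=1,\quad \mu_{O'}(|g\rangle\otimes|h\rangle)=\frac{1}{\omega\sqrt D}\,|gh\rangle,\quad \eta_{O'}(1)=\omega\sqrt D\,|e\rangle .$$ **Theorem.** 1. A pair of $\dagger$-SCFAs on $H$ is strongly complementary and normalised if and only if it has the form $(G,\{|g\rangle\},1)$ for some Abelian group $G$ of order $D$ and some orthonormal basis $\{|g\rangle\}$ indexed by $G$. 2. A pair of $\dagger$-SCFAs on $H$ is strongly complementary if and only if it has the form $(G,\{|g\rangle\},\omega)$ for some Abelian group $G$ of order $D$, some orthonormal basis $\{|g\rangle\}$ indexed by $G$ and some $\omega$ with $|\omega|=1$. 3. For every Abelian group $G$ of order $D$, every orthonormal basis of $H$ indexed by $G$ and every $\omega$ with $|\omega|=1$ there is exactly one pair of $\dagger$-SCFAs on $H$ of the form $(G,\{|g\rangle\},\omega)$.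 4. Sending a pair of the form $(G,\{|g\rangle\},1)$ to $G$ is a well-defined bijection from the normalised strongly complementary pairs on $H$, up to isomorphism (a unitary of $H$ carrying both algebras of one pair to those of the other), onto the isomorphism classes of Abelian groups of order $D$. 5. Sending a pair of the form $(G,\{|g\rangle\},\omega)$ to $G$ is likewise a well-defined bijection from all strongly complementary pairs on $H$, up to isomorphism and a global phase of $O'$ (replacing $(\mu,\eta,\delta,\epsilon)$ by $(\bar\omega\mu,\omega\eta,\omega\delta,\bar\omega\epsilon)$ with $|\omega|=1$), onto the isomorphism classes of Abelian groups of order $D$. -/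

import Mathlib

open scoped TensorProduct

universe u v

/-- A Frobenius algebra on `H` in the monoidal category of complex vector spaces: a monoid
`(mul, unit)` and a comonoid `(comul, counit)` which satisfy the Frobenius identity. -/
@[ext]
structure FrobAlg (H : Type*) [AddCommGroup H] [Module ℂ H] where
  mul : H ⊗[ℂ] H →ₗ[ℂ] H
  unit : ℂ →ₗ[ℂ] H
  comul : H →ₗ[ℂ] H ⊗[ℂ] H
  counit : H →ₗ[ℂ] ℂ
  mul_assoc : mul ∘ₗ mul.rTensor H =
    mul ∘ₗ mul.lTensor H ∘ₗ (TensorProduct.assoc ℂ H H H).toLinearMap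
  unit_mul : mul ∘ₗ unit.rTensor H = (TensorProduct.lid ℂ H).toLinearMap
  mul_unit : mul ∘ₗ unit.lTensor H = (TensorProduct.rid ℂ H).toLinearMap
  comul_coassoc : (TensorProduct.assoc ℂ H H H).toLinearMap ∘ₗ comul.rTensor H ∘ₗ comul =
    comul.lTensor H ∘ₗ comul
  counit_comul : counit.rTensor H ∘ₗ comul = (TensorProduct.lid ℂ H).symm.toLinearMap
  comul_counit : counit.lTensor H ∘ₗ comul = (TensorProduct.rid ℂ H).symm.toLinearMap
  frobenius_left : mul.rTensor H ∘ₗ (TensorProduct.assoc ℂ H H H).symm.toLinearMap ∘ₗ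
    comul.lTensor H = comul ∘ₗ mul
  frobenius_right : mul.lTensor H ∘ₗ (TensorProduct.assoc ℂ H H H).toLinearMap ∘ₗ
    comul.rTensor H = comul ∘ₗ mul

/-- A `†`-special commutative Frobenius algebra on a finite-dimensional complex Hilbert space.
The dagger is the Hilbert space adjoint; `H ⊗ H` carries the tensor product inner product. -/
@[ext]
structure DaggerSCFA (H : Type*) [NormedAddCommGroup H] [InnerProductSpace ℂ H]
    [FiniteDimensional ℂ H] extends FrobAlg H where
  mul_eq_adjoint : mul = LinearMap.adjoint comul
  unit_eq_adjoint : unit = LinearMap.adjoint counit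
  mul_comm : mul ∘ₗ (TensorProduct.comm ℂ H H).toLinearMap = mul
  special : mul ∘ₗ comul = LinearMap.id

section Pairs

variable {H : Type*} [NormedAddCommGroup H] [InnerProductSpace ℂ H] [FiniteDimensional ℂ H]

/-- The scalar `ε_O ∘ η_O'`. -/
def pairScalar (O O' : DaggerSCFA H) : ℂ := O.counit (O'.unit 1)

/-- The scaled bialgebra equations for the monoid of `O'` and the comonoid of `O`; the scalar is
`ε_O ∘ η_O'`. -/
structure StronglyComplementary (O O' : DaggerSCFA H) : Prop where
  comul_mul : O.comul ∘ₗ O'.mul = pairScalar O O' •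
    (TensorProduct.map O'.mul O'.mul ∘ₗ
      (TensorProduct.tensorTensorTensorComm ℂ H H H H).toLinearMap ∘ₗ
      TensorProduct.map O.comul O.comul)
  comul_unit : pairScalar O O' • (O.comul ∘ₗ O'.unit) =
    TensorProduct.map O'.unit O'.unit ∘ₗ (TensorProduct.lid ℂ ℂ).symm.toLinearMap
  counit_mul : pairScalar O O' • (O.counit ∘ₗ O'.mul) =
    (TensorProduct.lid ℂ ℂ).toLinearMap ∘ₗ TensorProduct.map O.counit O.counit

/-- `O` copies and deletes the orthonormal basis `|g⟩ = b g`, and `O'` has the multiplication and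
the unit of the group algebra of `G` on this basis, scaled by the inverse of `ω √|G|` and by
`ω √|G|` respectively. -/
structure HasGroupForm {G : Type*} [CommGroup G] [Fintype G] (O O' : DaggerSCFA H)
    (b : OrthonormalBasis G ℂ H) (ω : Circle) : Prop where
  comul_basis : ∀ g, O.comul (b g) = b g ⊗ₜ[ℂ] b g
  counit_basis : ∀ g, O.counit (b g) = 1
  mul_basis : ∀ g h, O'.mul (b g ⊗ₜ[ℂ] b h) =
    ((ω : ℂ) * (Real.sqrt (Fintype.card G) : ℂ))⁻¹ • b (g * h)
  unit_one : O'.unit 1 = ((ω : ℂ) * (Real.sqrt (Fintype.card G) : ℂ)) • b 1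

/-- The unitary `U` carries `A` to `B` up to the global phase `ω`; for `ω = 1` it is an isomorphism
of `†`-Frobenius algebras. -/
structure Carries (U : H ≃ₗᵢ[ℂ] H) (ω : Circle) (A B : DaggerSCFA H) : Prop where
  mul_eq : U.toLinearMap ∘ₗ A.mul =
    ((ω⁻¹ : Circle) : ℂ) • (B.mul ∘ₗ TensorProduct.map U.toLinearMap U.toLinearMap)
  unit_eq : U.toLinearMap ∘ₗ A.unit = (ω : ℂ) • B.unit
  comul_eq : TensorProduct.map U.toLinearMap U.toLinearMap ∘ₗ A.comul =
    (ω : ℂ) • (B.comul ∘ₗ U.toLinearMap)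
  counit_eq : A.counit = ((ω⁻¹ : Circle) : ℂ) • (B.counit ∘ₗ U.toLinearMap)

theorem Carries.refl (A : DaggerSCFA H) : Carries (LinearIsometryEquiv.refl ℂ H) 1 A A := by
  refine ⟨?_, ?_, ?_, ?_⟩ <;> simp [TensorProduct.map_id]

theorem Carries.symm {U : H ≃ₗᵢ[ℂ] H} {ω : Circle} {A B : DaggerSCFA H}
    (h : Carries U ω A B) : Carries U.symm ω⁻¹ B A := by
  have e1 : U.symm.toLinearMap ∘ₗ U.toLinearMap = LinearMap.id := by
    ext x; exact U.symm_apply_apply x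
  have e2 : U.toLinearMap ∘ₗ U.symm.toLinearMap = LinearMap.id := by
    ext x; exact U.apply_symm_apply x
  have m1 : TensorProduct.map U.symm.toLinearMap U.symm.toLinearMap ∘ₗ
      TensorProduct.map U.toLinearMap U.toLinearMap = LinearMap.id := by
    rw [← TensorProduct.map_comp, e1, TensorProduct.map_id]
  have m2 : TensorProduct.map U.toLinearMap U.toLinearMap ∘ₗ
      TensorProduct.map U.symm.toLinearMap U.symm.toLinearMap = LinearMap.id := by
    rw [← TensorProduct.map_comp, e2, TensorProduct.map_id]
  have hω : (ω : ℂ) ≠ 0 := ω.coe_ne_zero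
  refine ⟨?_, ?_, ?_, ?_⟩
  · have := congrArg (fun f => (ω : ℂ) • (U.symm.toLinearMap ∘ₗ f ∘ₗ
      TensorProduct.map U.symm.toLinearMap U.symm.toLinearMap)) h.mul_eq
    simp only [LinearMap.smul_comp, LinearMap.comp_smul, LinearMap.comp_assoc, m2,
      LinearMap.comp_id, smul_smul, Circle.coe_inv, mul_inv_cancel₀ hω, one_smul] at this
    rw [← LinearMap.comp_assoc, e1, LinearMap.id_comp] at this
    simpa using this.symm
  · have := congrArg (fun f => ((ω : ℂ)⁻¹) • (U.symm.toLinearMap ∘ₗ f)) h.unit_eq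
    simp only [LinearMap.comp_smul, smul_smul, inv_mul_cancel₀ hω, one_smul] at this
    rw [← LinearMap.comp_assoc, e1, LinearMap.id_comp] at this
    simpa using this.symm
  · have := congrArg (fun f => ((ω : ℂ)⁻¹) •
      (TensorProduct.map U.symm.toLinearMap U.symm.toLinearMap ∘ₗ f ∘ₗ U.symm.toLinearMap))
      h.comul_eq
    simp only [LinearMap.smul_comp, LinearMap.comp_smul, LinearMap.comp_assoc, e2,
      LinearMap.comp_id, smul_smul, inv_mul_cancel₀ hω, one_smul] at this
    rw [← LinearMap.comp_assoc, m1, LinearMap.id_comp] at this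
    simpa using this.symm
  · have := congrArg (fun f => (ω : ℂ) • (f ∘ₗ U.symm.toLinearMap)) h.counit_eq
    simp only [LinearMap.smul_comp, LinearMap.comp_assoc, e2, LinearMap.comp_id, smul_smul,
      Circle.coe_inv, mul_inv_cancel₀ hω, one_smul] at this
    simpa using this.symm

theorem Carries.trans {U V : H ≃ₗᵢ[ℂ] H} {ω ν : Circle} {A B C : DaggerSCFA H}
    (h : Carries U ω A B) (k : Carries V ν B C) : Carries (U.trans V) (ω * ν) A C := by
  have e : (U.trans V).toLinearMap = V.toLinearMap ∘ₗ U.toLinearMap := rfl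
  refine ⟨?_, ?_, ?_, ?_⟩
  · rw [e, TensorProduct.map_comp, LinearMap.comp_assoc, h.mul_eq, LinearMap.comp_smul,
      ← LinearMap.comp_assoc, k.mul_eq, LinearMap.smul_comp, smul_smul, LinearMap.comp_assoc]
    simp [_root_.mul_comm]
  · rw [e, LinearMap.comp_assoc, h.unit_eq, LinearMap.comp_smul, k.unit_eq, smul_smul]
    simp
  · rw [e, TensorProduct.map_comp, LinearMap.comp_assoc, h.comul_eq, LinearMap.comp_smul,
      ← LinearMap.comp_assoc, k.comul_eq, LinearMap.smul_comp, smul_smul, LinearMap.comp_assoc]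
    simp
  · rw [e, h.counit_eq, k.counit_eq, LinearMap.smul_comp, smul_smul, LinearMap.comp_assoc]
    simp [_root_.mul_comm]

end Pairs

section Classes

variable (H : Type*) [NormedAddCommGroup H] [InnerProductSpace ℂ H] [FiniteDimensional ℂ H]

/-- The strongly complementary pairs on `H`. -/
def SCPair : Type _ := {p : DaggerSCFA H × DaggerSCFA H // StronglyComplementary p.1 p.2}

/-- The strongly complementary pairs on `H` with `ε_O ∘ η_O' = √(dim H)`. -/
def NormalisedSCPair : Type _ := {p : DaggerSCFA H × DaggerSCFA H //
  StronglyComplementary p.1 p.2 ∧ pairScalar p.1 p.2 = (Real.sqrt (Module.finrank ℂ H) : ℂ)}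

/-- Isomorphism of pairs: one unitary carries both algebras of the first pair to those of the
second. -/
def pairIso : Setoid (NormalisedSCPair H) where
  r p q := ∃ U : H ≃ₗᵢ[ℂ] H, Carries U 1 p.1.1 q.1.1 ∧ Carries U 1 p.1.2 q.1.2
  iseqv :=
    { refl := fun _ => ⟨_, Carries.refl _, Carries.refl _⟩
      symm := fun ⟨_, h, k⟩ => ⟨_, by simpa using h.symm, by simpa using k.symm⟩
      trans := fun ⟨_, h, k⟩ ⟨_, h', k'⟩ =>
        ⟨_, by simpa using h.trans h', by simpa using k.trans k'⟩ }

/-- Isomorphism of pairs up to a relative global phase. -/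
def pairPhaseIso : Setoid (SCPair H) where
  r p q := ∃ (U : H ≃ₗᵢ[ℂ] H) (ω : Circle), Carries U 1 p.1.1 q.1.1 ∧ Carries U ω p.1.2 q.1.2
  iseqv :=
    { refl := fun _ => ⟨_, _, Carries.refl _, Carries.refl _⟩
      symm := fun ⟨_, _, h, k⟩ => ⟨_, _, by simpa using h.symm, k.symm⟩
      trans := fun ⟨_, _, h, k⟩ ⟨_, _, h', k'⟩ => ⟨_, _, by simpa using h.trans h', k.trans k'⟩ }

end Classes

/-- The Abelian groups of order `D`. For `D ≥ 1` these are finite. -/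
def AbGroupOfOrder (D : ℕ) : Type _ := {G : CommGrpCat // Nat.card G = D}

/-- Isomorphism of Abelian groups. -/
def groupIso (D : ℕ) : Setoid (AbGroupOfOrder D) where
  r G K := Nonempty (G.1 ≃* K.1)
  iseqv :=
    { refl := fun _ => ⟨MulEquiv.refl _⟩
      symm := fun ⟨e⟩ => ⟨e.symm⟩
      trans := fun ⟨e⟩ ⟨f⟩ => ⟨e.trans f⟩ }

/-! The vectors copied and deleted by `O` (its classical vectors) form an orthonormal basis, and
strong complementarity makes `O'` multiply them as a group, up to a scalar. Basis: the Frobenius law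
says that left multiplications are closed under adjoints (`adjoint_mulLeft`). They commute, so they
are normal, and a nonzero one is not nilpotent. Hence characters separate vectors, and the Riesz
vector of a character is classical. Speciality forces inner products of classical vectors to be 0 or
1. Group: with `s` the pair scalar, the bialgebra equations make `s • μ'(c ⊗ d)` and `s⁻¹ • η'(1)`
classical, which gives a commutative monoid on the basis. Inverses come from the closure under
adjoints for `O'`. The squared norm of `η'(1)` is the dimension, so `s` is `√D` times a phase.
Conversely, direct computation on a basis shows that the group form defines `†`-SCFAs and is
strongly complementary. Since the classical vectors are intrinsic to `O`, the pair determines its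
group, and an isomorphism of groups permutes basis vectors by a unitary. -/

section PartialInner

variable {H : Type*} [NormedAddCommGroup H] [InnerProductSpace ℂ H]

/-- Contraction of the first tensor factor with the vector `x`. -/
noncomputable def innerContract (x : H) : H ⊗[ℂ] H →ₗ[ℂ] H :=
  (TensorProduct.lid ℂ H).toLinearMap ∘ₗ (innerₛₗ ℂ x).rTensor H

theorem innerContract_tmul (x y z : H) : innerContract x (y ⊗ₜ[ℂ] z) = inner ℂ x y • z := by
  simp [innerContract]

theorem inner_innerContract (x y : H) (t : H ⊗[ℂ] H) :
    inner ℂ y (innerContract x t) = inner ℂ (x ⊗ₜ[ℂ] y) t := by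
  induction t using TensorProduct.induction_on with
  | zero => simp
  | tmul a b => simp [innerContract_tmul]
  | add s t hs ht => rw [map_add, inner_add_right, inner_add_right, hs, ht]

end PartialInner

/-! ### Left multiplications as a commutative algebra closed under adjoints -/

namespace DaggerSCFA

variable {H : Type*} [NormedAddCommGroup H] [InnerProductSpace ℂ H] [FiniteDimensional ℂ H]

theorem inner_mul_left (O : DaggerSCFA H) (t : H ⊗[ℂ] H) (z : H) :
    inner ℂ (O.mul t) z = inner ℂ t (O.comul z) := by
  rw [O.mul_eq_adjoint, LinearMap.adjoint_inner_left]

theorem inner_mul_right (O : DaggerSCFA H) (t : H ⊗[ℂ] H) (z : H) :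
    inner ℂ z (O.mul t) = inner ℂ (O.comul z) t := by
  rw [O.mul_eq_adjoint, LinearMap.adjoint_inner_right]

theorem inner_unit_one (O : DaggerSCFA H) (z : H) :
    inner ℂ (O.unit 1) z = O.counit z := by
  rw [O.unit_eq_adjoint, LinearMap.adjoint_inner_left]
  simp

theorem unit_mul_apply (O : DaggerSCFA H) (z : H) : O.mul (O.unit 1 ⊗ₜ[ℂ] z) = z := by
  simpa using LinearMap.congr_fun O.unit_mul (1 ⊗ₜ[ℂ] z)

theorem mul_unit_apply (O : DaggerSCFA H) (z : H) : O.mul (z ⊗ₜ[ℂ] O.unit 1) = z := by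
  simpa using LinearMap.congr_fun O.mul_unit (z ⊗ₜ[ℂ] 1)

theorem mul_assoc_apply (O : DaggerSCFA H) (x y z : H) :
    O.mul (O.mul (x ⊗ₜ[ℂ] y) ⊗ₜ[ℂ] z) = O.mul (x ⊗ₜ[ℂ] O.mul (y ⊗ₜ[ℂ] z)) := by
  simpa using LinearMap.congr_fun O.mul_assoc ((x ⊗ₜ[ℂ] y) ⊗ₜ[ℂ] z)

theorem mul_comm_apply (O : DaggerSCFA H) (x y : H) :
    O.mul (x ⊗ₜ[ℂ] y) = O.mul (y ⊗ₜ[ℂ] x) := by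
  simpa using LinearMap.congr_fun O.mul_comm (y ⊗ₜ[ℂ] x)

theorem mul_comul_apply (O : DaggerSCFA H) (x : H) : O.mul (O.comul x) = x :=
  LinearMap.congr_fun O.special x

theorem comul_eq_adjoint (O : DaggerSCFA H) : O.comul = LinearMap.adjoint O.mul := by
  rw [O.mul_eq_adjoint, LinearMap.adjoint_adjoint]

theorem counit_eq_adjoint (O : DaggerSCFA H) : O.counit = LinearMap.adjoint O.unit := by
  rw [O.unit_eq_adjoint, LinearMap.adjoint_adjoint]

theorem ext_of_comul_counit {A B : DaggerSCFA H} (h : A.comul = B.comul)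
    (k : A.counit = B.counit) : A = B := by
  ext1
  · rw [A.mul_eq_adjoint, h, B.mul_eq_adjoint]
  · rw [A.unit_eq_adjoint, k, B.unit_eq_adjoint]
  · exact h
  · exact k

theorem ext_of_mul_unit {A B : DaggerSCFA H} (h : A.mul = B.mul) (k : A.unit = B.unit) :
    A = B :=
  ext_of_comul_counit (by rw [A.comul_eq_adjoint, h, B.comul_eq_adjoint])
    (by rw [A.counit_eq_adjoint, k, B.counit_eq_adjoint])

/-- The involution for which left multiplication is a `*`-homomorphism. -/
noncomputable def conj (O : DaggerSCFA H) (x : H) : H := innerContract x (O.comul (O.unit 1))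

/-- At `η(1) ⊗ z` the Frobenius law reads `δ z = (1 ⊗ μ)(δ η(1) ⊗ z)`. Contracting the first factor
with `x` turns the right side into the product of `conj x` and `z`. -/
theorem inner_mul_tmul_left (O : DaggerSCFA H) (x y z : H) :
    inner ℂ (O.mul (x ⊗ₜ[ℂ] y)) z = inner ℂ y (O.mul (O.conj x ⊗ₜ[ℂ] z)) := by
  have key : ∀ t : H ⊗[ℂ] H, innerContract x (O.mul.lTensor H
      (TensorProduct.assoc ℂ H H H (t ⊗ₜ[ℂ] z))) = O.mul (innerContract x t ⊗ₜ[ℂ] z) := by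
    intro t
    induction t using TensorProduct.induction_on with
    | zero => simp
    | tmul a b => simp [innerContract_tmul, ← TensorProduct.smul_tmul']
    | add s t hs ht => simp only [TensorProduct.add_tmul, map_add, hs, ht]
  have frob := LinearMap.congr_fun O.frobenius_right (O.unit 1 ⊗ₜ[ℂ] z)
  simp only [LinearMap.comp_apply, LinearEquiv.coe_coe, LinearMap.rTensor_tmul,
    O.unit_mul_apply] at frob
  rw [O.inner_mul_left, ← inner_innerContract, ← frob, key, conj]

/-- Left multiplication by `x`. -/
noncomputable def mulLeft (O : DaggerSCFA H) : H →ₗ[ℂ] Module.End ℂ H := TensorProduct.curry O.mul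

theorem mulLeft_apply (O : DaggerSCFA H) (x y : H) : O.mulLeft x y = O.mul (x ⊗ₜ[ℂ] y) := rfl

theorem mulLeft_unit (O : DaggerSCFA H) : O.mulLeft (O.unit 1) = 1 :=
  LinearMap.ext fun z => O.unit_mul_apply z

theorem mulLeft_mul (O : DaggerSCFA H) (x y : H) :
    O.mulLeft (O.mul (x ⊗ₜ[ℂ] y)) = O.mulLeft x * O.mulLeft y :=
  LinearMap.ext fun z => O.mul_assoc_apply x y z

theorem mulLeft_comm (O : DaggerSCFA H) (x y : H) :
    O.mulLeft x * O.mulLeft y = O.mulLeft y * O.mulLeft x := by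
  rw [← mulLeft_mul, ← mulLeft_mul, O.mul_comm_apply]

theorem eq_zero_of_mulLeft_eq_zero (O : DaggerSCFA H) {x : H} (h : O.mulLeft x = 0) : x = 0 := by
  rw [← O.mul_unit_apply x, ← mulLeft_apply, h, LinearMap.zero_apply]

theorem adjoint_mulLeft (O : DaggerSCFA H) (x : H) :
    LinearMap.adjoint (O.mulLeft x) = O.mulLeft (O.conj x) := by
  rw [eq_comm, LinearMap.eq_adjoint_iff]
  intro z y
  have := O.inner_mul_tmul_left x y z
  rw [← inner_conj_symm, mulLeft_apply, ← this, inner_conj_symm, mulLeft_apply]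

/-- A nilpotent normal operator vanishes: if `T` is nilpotent and commutes with its adjoint, then
`T†T` is both nilpotent and self-adjoint, hence zero, and so is `T`. Semisimplicity of the algebra
enters here. -/
theorem not_isNilpotent_mulLeft (O : DaggerSCFA H) {x : H} (hx : x ≠ 0) :
    ¬ IsNilpotent (O.mulLeft x) := by
  intro hn
  set T := O.mulLeft x
  have hc : Commute (LinearMap.adjoint T) T := by
    rw [O.adjoint_mulLeft]; exact O.mulLeft_comm _ _
  have hS : (LinearMap.adjoint T * T).IsSymmetric := by
    intro y z
    simp only [Module.End.mul_apply]
    rw [LinearMap.adjoint_inner_left, LinearMap.adjoint_inner_right]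
  have h0 : LinearMap.adjoint T * T = 0 :=
    Module.End.eq_zero_of_isNilpotent_of_isFinitelySemisimple (hc.isNilpotent_mul_left hn)
      hS.isFinitelySemisimple
  refine hx (O.eq_zero_of_mulLeft_eq_zero (LinearMap.ext fun y => ?_))
  have := LinearMap.congr_fun h0 y
  refine (inner_self_eq_zero (𝕜 := ℂ)).mp ?_
  change inner ℂ (T y) (T y) = 0
  rw [← LinearMap.adjoint_inner_right]
  simp only [Module.End.mul_apply, LinearMap.zero_apply] at this
  rw [this, inner_zero_right]

end DaggerSCFA

/-- In a finite-dimensional commutative algebra over an algebraically closed field the characters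
detect the elements which are not nilpotent. -/
theorem exists_algHom_ne_zero_of_not_isNilpotent {k A : Type*} [Field k] [IsAlgClosed k]
    [CommRing A] [Algebra k A] [FiniteDimensional k A] {a : A} (ha : ¬ IsNilpotent a) :
    ∃ φ : A →ₐ[k] k, φ a ≠ 0 := by
  rw [nilpotent_iff_mem_prime] at ha
  push Not at ha
  obtain ⟨J, hJ, haJ⟩ := ha
  -- The quotient by a prime is a domain integral over the algebraically closed field `k`, hence
  -- equal to `k`.
  have hb : Function.Bijective (algebraMap k (A ⧸ J)) :=
    IsAlgClosed.algebraMap_bijective_of_isIntegral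
  let e : k ≃ₐ[k] A ⧸ J := AlgEquiv.ofBijective (Algebra.ofId k (A ⧸ J)) hb
  refine ⟨e.symm.toAlgHom.comp (Ideal.Quotient.mkₐ k J), fun h => haJ ?_⟩
  rw [← Ideal.Quotient.eq_zero_iff_mem]
  exact e.symm.map_eq_zero_iff.mp h

/-! ### Characters and the orthonormal basis of classical vectors -/

namespace DaggerSCFA

variable {H : Type*} [NormedAddCommGroup H] [InnerProductSpace ℂ H] [FiniteDimensional ℂ H]

/-- The left multiplications generate a commutative finite-dimensional algebra in which that of `x`
is not nilpotent; a character of this algebra is pulled back to `H`. -/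
theorem exists_character (O : DaggerSCFA H) {x : H} (hx : x ≠ 0) :
    ∃ χ : H →ₗ[ℂ] ℂ, (∀ y z, χ (O.mul (y ⊗ₜ[ℂ] z)) = χ y * χ z) ∧ χ (O.unit 1) = 1 ∧ χ x ≠ 0 := by
  let S : Set (Module.End ℂ H) := Set.range O.mulLeft
  have hS : IsMulCommutative (Algebra.adjoin ℂ S) := Algebra.isMulCommutative_adjoin ℂ (by
    rintro _ ⟨y, rfl⟩ _ ⟨z, rfl⟩
    exact O.mulLeft_comm y z)
  let _ : CommRing (Algebra.adjoin ℂ S) :=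
    { (inferInstance : Ring (Algebra.adjoin ℂ S)) with mul_comm := hS.is_comm.comm }
  let L : H →ₗ[ℂ] Algebra.adjoin ℂ S :=
    O.mulLeft.codRestrict (Subalgebra.toSubmodule (Algebra.adjoin ℂ S))
      fun y => Algebra.subset_adjoin ⟨y, rfl⟩
  have : FiniteDimensional ℂ (Algebra.adjoin ℂ S) :=
    inferInstanceAs (FiniteDimensional ℂ (Subalgebra.toSubmodule (Algebra.adjoin ℂ S)))
  have hL : ¬ IsNilpotent (L x) := fun h =>
    O.not_isNilpotent_mulLeft hx (h.map (Algebra.adjoin ℂ S).val)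
  obtain ⟨φ, hφ⟩ := exists_algHom_ne_zero_of_not_isNilpotent (k := ℂ)
    (A := Algebra.adjoin ℂ S) hL
  refine ⟨φ.toLinearMap ∘ₗ L, fun y z => ?_, ?_, hφ⟩
  · have : L (O.mul (y ⊗ₜ[ℂ] z)) = L y * L z := Subtype.ext (O.mulLeft_mul y z)
    simp [this]
  · have : L (O.unit 1) = 1 := Subtype.ext O.mulLeft_unit
    simp [this]

/-- The vectors which are copied and deleted. -/
def IsClassical (O : DaggerSCFA H) (c : H) : Prop := O.comul c = c ⊗ₜ[ℂ] c ∧ O.counit c = 1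

/-- The witness is the Riesz vector of a character not vanishing at `x`. Under the adjoint,
multiplicativity becomes copying and unitality becomes deletion. -/
theorem exists_isClassical_inner_ne_zero (O : DaggerSCFA H) {x : H} (hx : x ≠ 0) :
    ∃ c, O.IsClassical c ∧ inner ℂ c x ≠ 0 := by
  obtain ⟨χ, hm, hu, hχ⟩ := O.exists_character hx
  have hc : ∀ y, inner ℂ (LinearMap.adjoint χ 1) y = χ y := fun y => by
    rw [LinearMap.adjoint_inner_left]; simp
  refine ⟨LinearMap.adjoint χ 1, ⟨?_, ?_⟩, by rwa [hc]⟩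
  · rw [TensorProduct.ext_iff_inner_right]
    intro y z
    rw [← O.inner_mul_right, hc, hm, TensorProduct.inner_tmul, hc, hc]
  · rw [← O.inner_unit_one, ← inner_conj_symm, hc, hu, map_one]

theorem IsClassical.ne_zero {O : DaggerSCFA H} {c : H} (h : O.IsClassical c) : c ≠ 0 := by
  rintro rfl
  simpa using h.2

/-- By copying, the square is `⟨δ c, δ d⟩ = ⟨c, μ δ d⟩`, and `μ δ = 1`. So the inner product is 0 or
1. -/
theorem IsClassical.inner_mul_self {O : DaggerSCFA H} {c d : H} (h : O.IsClassical c)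
    (k : O.IsClassical d) : inner ℂ c d * inner ℂ c d = inner ℂ c d := by
  rw [← TensorProduct.inner_tmul, ← h.1, ← k.1, ← O.inner_mul_right, O.mul_comul_apply]

theorem IsClassical.inner_self {O : DaggerSCFA H} {c : H} (h : O.IsClassical c) :
    inner ℂ c c = (1 : ℂ) :=
  mul_right_cancel₀ (inner_self_ne_zero.mpr h.ne_zero) (by rw [h.inner_mul_self h, one_mul])

theorem IsClassical.eq_of_inner_ne_zero {O : DaggerSCFA H} {c d : H} (h : O.IsClassical c)
    (k : O.IsClassical d) (hcd : inner ℂ c d ≠ (0 : ℂ)) : c = d := by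
  have h1 : inner ℂ c d = (1 : ℂ) := mul_right_cancel₀ hcd (by rw [h.inner_mul_self k, one_mul])
  have h2 : inner ℂ d c = (1 : ℂ) := by rw [← inner_conj_symm, h1, map_one]
  refine sub_eq_zero.mp ((inner_self_eq_zero (𝕜 := ℂ)).mp ?_)
  rw [inner_sub_left, inner_sub_right, inner_sub_right, h1, h2, h.inner_self, k.inner_self]
  ring

theorem orthonormal_isClassical (O : DaggerSCFA H) :
    Orthonormal ℂ (Subtype.val : {c // O.IsClassical c} → H) := by
  classical
  rw [orthonormal_iff_ite]
  rintro ⟨c, hc⟩ ⟨d, hd⟩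
  split_ifs with h
  · obtain rfl := Subtype.ext_iff.mp h
    exact hc.inner_self
  · by_contra h0
    exact h (Subtype.ext (hc.eq_of_inner_ne_zero hd h0))

/-- The classical vectors form an orthonormal basis. -/
theorem exists_orthonormalBasis_isClassical (O : DaggerSCFA H) {ι : Type*} [Fintype ι]
    (hι : Fintype.card ι = Module.finrank ℂ H) :
    ∃ b : OrthonormalBasis ι ℂ H, ∀ i, O.IsClassical (b i) := by
  have ho := O.orthonormal_isClassical
  have : Finite {c // O.IsClassical c} := ho.linearIndependent.finite
  have _ := Fintype.ofFinite {c // O.IsClassical c}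
  -- A nonzero vector orthogonal to all classical vectors would contradict
  -- `exists_isClassical_inner_ne_zero`.
  let b := OrthonormalBasis.mkOfOrthogonalEqBot ho (by
    rw [Submodule.eq_bot_iff]
    intro x hx
    by_contra h0
    obtain ⟨c, hc, hcx⟩ := O.exists_isClassical_inner_ne_zero h0
    exact hcx (Submodule.inner_right_of_mem_orthogonal (Submodule.subset_span (Set.mem_range_self (⟨c, hc⟩ : {c // O.IsClassical c}))) hx))
  have hcard : Fintype.card {c // O.IsClassical c} = Fintype.card ι := by
    rw [hι, Module.finrank_eq_card_basis b.toBasis]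
  let e := Fintype.equivOfCardEq hcard
  refine ⟨b.reindex e, fun i => ?_⟩
  simpa [b] using (e.symm i).2

theorem IsClassical.exists_eq {O : DaggerSCFA H} {ι : Type*} [Fintype ι]
    {b : OrthonormalBasis ι ℂ H} (hb : ∀ i, O.IsClassical (b i)) {c : H} (hc : O.IsClassical c) :
    ∃ i, c = b i := by
  by_contra! h
  refine hc.ne_zero (InnerProductSpace.ext_inner_left_basis b.toBasis fun i => ?_)
  rw [inner_zero_right, b.coe_toBasis]
  by_contra h0
  exact h i ((hb i).eq_of_inner_ne_zero hc h0).symm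

/-- The unit has coordinate 1 along each classical vector, because the counit deletes it; Parseval
counts these coordinates. -/
theorem inner_unit_one_self (O : DaggerSCFA H) :
    inner ℂ (O.unit 1) (O.unit 1) = (Module.finrank ℂ H : ℂ) := by
  obtain ⟨b, hb⟩ := O.exists_orthonormalBasis_isClassical
    (Fintype.card_fin (Module.finrank ℂ H))
  rw [← b.sum_inner_mul_inner]
  have : ∀ i, inner ℂ (O.unit 1) (b i) = (1 : ℂ) := fun i => by
    rw [O.inner_unit_one, (hb i).2]
  have h' : ∀ i, inner ℂ (b i) (O.unit 1) = (1 : ℂ) := fun i => by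
    rw [← inner_conj_symm, this, map_one]
  simp [this, h']

end DaggerSCFA

/-! ### Strongly complementary pairs and groups -/

section GroupForm

variable {H : Type*} [NormedAddCommGroup H] [InnerProductSpace ℂ H] [FiniteDimensional ℂ H]

theorem Circle.exists_coe_eq {z : ℂ} (hz : ‖z‖ = 1) : ∃ ω : Circle, (ω : ℂ) = z :=
  ⟨⟨z, mem_sphere_zero_iff_norm.mpr hz⟩, rfl⟩

namespace Carries

variable {U : H ≃ₗᵢ[ℂ] H} {ω : Circle} {A B : DaggerSCFA H}

/-- The monoid is the adjoint of the comonoid, `U` preserves inner products, and the conjugate of a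
phase is its inverse. So one half of the conditions suffices. -/
theorem of_comul_counit (h : TensorProduct.map U.toLinearMap U.toLinearMap ∘ₗ A.comul =
      (ω : ℂ) • (B.comul ∘ₗ U.toLinearMap))
    (k : A.counit = ((ω⁻¹ : Circle) : ℂ) • (B.counit ∘ₗ U.toLinearMap)) : Carries U ω A B := by
  have hω : (ω : ℂ) ≠ 0 := ω.coe_ne_zero
  refine ⟨LinearMap.ext fun t => ?_, LinearMap.ext_ring ?_, h, k⟩
  · refine ext_inner_right ℂ fun w => ?_
    obtain ⟨z, rfl⟩ := U.surjective w
    have h1 := LinearMap.congr_fun h z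
    have h2 := TensorProduct.inner_map_map U.toLinearIsometry U.toLinearIsometry t (A.comul z)
    change inner ℂ (U (A.mul t)) (U z) = inner ℂ (((ω⁻¹ : Circle) : ℂ) • B.mul _) (U z)
    rw [U.inner_map_map, A.inner_mul_left, ← h2, inner_smul_left, B.inner_mul_left]
    refine (congrArg _ h1).trans ?_
    rw [LinearMap.smul_apply, inner_smul_right, Circle.coe_inv_eq_conj, Complex.conj_conj]
    rfl
  · refine ext_inner_right ℂ fun w => ?_
    obtain ⟨z, rfl⟩ := U.surjective w
    have h1 := LinearMap.congr_fun k z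
    change inner ℂ (U (A.unit 1)) (U z) = inner ℂ ((ω : ℂ) • B.unit 1) (U z)
    rw [U.inner_map_map, A.inner_unit_one, inner_smul_left, B.inner_unit_one, h1,
      Circle.coe_inv_eq_conj]
    rfl

theorem of_mul_unit (h : U.toLinearMap ∘ₗ A.mul =
      ((ω⁻¹ : Circle) : ℂ) • (B.mul ∘ₗ TensorProduct.map U.toLinearMap U.toLinearMap))
    (k : U.toLinearMap ∘ₗ A.unit = (ω : ℂ) • B.unit) : Carries U ω A B := by
  refine ⟨h, k, LinearMap.ext fun z => ?_, LinearMap.ext fun z => ?_⟩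
  · have hs : Function.Surjective (TensorProduct.map U.toLinearMap U.toLinearMap) :=
      TensorProduct.map_surjective U.surjective U.surjective
    refine ext_inner_left ℂ fun w => ?_
    obtain ⟨t, rfl⟩ := hs w
    have h1 := LinearMap.congr_fun h t
    have h2 := TensorProduct.inner_map_map U.toLinearIsometry U.toLinearIsometry t (A.comul z)
    refine h2.trans ?_
    rw [← A.inner_mul_left, ← U.inner_map_map]
    refine (congrArg (fun x => inner ℂ x (U z)) h1).trans ?_
    rw [LinearMap.smul_apply, inner_smul_left, LinearMap.smul_apply, inner_smul_right,
      Circle.coe_inv_eq_conj, Complex.conj_conj]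
    exact congrArg _ (B.inner_mul_left _ _)
  · have h1 := LinearMap.congr_fun k 1
    rw [← A.inner_unit_one, ← U.inner_map_map]
    refine (congrArg (fun x => inner ℂ x (U z)) h1).trans ?_
    rw [LinearMap.smul_apply, inner_smul_left, LinearMap.smul_apply, Circle.coe_inv_eq_conj]
    exact congrArg _ (B.inner_unit_one _)

end Carries

namespace StronglyComplementary

variable {O O' : DaggerSCFA H}

/-- On copied vectors the bialgebra law reads `δ p = s • (p ⊗ p)` with `p = μ'(c ⊗ d)`, so rescaling
`p` by `s` makes it copied. -/
theorem isClassical_smul_mul (h : StronglyComplementary O O') {c d : H} (hc : O.IsClassical c)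
    (hd : O.IsClassical d) : O.IsClassical (pairScalar O O' • O'.mul (c ⊗ₜ[ℂ] d)) := by
  have h1 := LinearMap.congr_fun h.comul_mul (c ⊗ₜ[ℂ] d)
  have h2 := LinearMap.congr_fun h.counit_mul (c ⊗ₜ[ℂ] d)
  simp [hc.1, hd.1, hc.2, hd.2] at h1 h2
  refine ⟨?_, by simpa using h2⟩
  rw [map_smul, h1, TensorProduct.tmul_smul, ← TensorProduct.smul_tmul']

theorem isClassical_smul_unit (h : StronglyComplementary O O') (hs : pairScalar O O' ≠ 0) :
    O.IsClassical ((pairScalar O O')⁻¹ • O'.unit 1) := by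
  have h1 := LinearMap.congr_fun h.comul_unit 1
  simp at h1
  refine ⟨?_, by rw [map_smul]; exact inv_mul_cancel₀ hs⟩
  rw [TensorProduct.tmul_smul, ← TensorProduct.smul_tmul', ← h1, map_smul, inv_smul_smul₀ hs]

/-- The classical vectors of `O` carry a group structure given by the multiplication of `O'`. -/
theorem exists_hasGroupForm (h : StronglyComplementary O O') {ι : Type*} [Fintype ι] [Nonempty ι]
    (hι : Fintype.card ι = Module.finrank ℂ H) :
    ∃ (_ : CommGroup ι) (b : OrthonormalBasis ι ℂ H) (ω : Circle), HasGroupForm O O' b ω := by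
  obtain ⟨b, hb⟩ := O.exists_orthonormalBasis_isClassical hι
  have hinj : Function.Injective b := by simpa using b.toBasis.injective
  choose m hm using fun i j => (h.isClassical_smul_mul (hb i) (hb j)).exists_eq hb
  -- For `s = 0` the classical vector `s • μ'(b i ⊗ b i)` would be zero. An index is needed, whence
  -- `Nonempty ι`.
  have hs : pairScalar O O' ≠ 0 := by
    intro h0
    obtain ⟨i⟩ := ‹Nonempty ι›
    exact (hb (m i i)).ne_zero (by rw [← hm, h0, zero_smul])
  obtain ⟨e, he⟩ := (h.isClassical_smul_unit hs).exists_eq hb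
  set s := pairScalar O O'
  have hmul : ∀ i j, O'.mul (b i ⊗ₜ[ℂ] b j) = s⁻¹ • b (m i j) := fun i j => by
    rw [← hm, inv_smul_smul₀ hs]
  have hunit : O'.unit 1 = s • b e := by rw [← he, smul_inv_smul₀ hs]
  have hcomm : ∀ i j, m i j = m j i := fun i j => hinj (by
    rw [← hm, ← hm, O'.mul_comm_apply])
  have hassoc : ∀ i j k, m (m i j) k = m i (m j k) := fun i j k => hinj (by
    have := O'.mul_assoc_apply (b i) (b j) (b k)
    simp only [hmul, ← TensorProduct.smul_tmul', TensorProduct.tmul_smul, map_smul] at this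
    exact smul_right_injective H (inv_ne_zero hs) (smul_right_injective H (inv_ne_zero hs) this))
  have hone : ∀ i, m e i = i := fun i => hinj (by
    have := O'.unit_mul_apply (b i)
    rwa [hunit, ← TensorProduct.smul_tmul', map_smul, hmul, smul_inv_smul₀ hs] at this)
  -- If no product with `i` is `e`, the adjoint of multiplication by `b i` kills `b e`, hence the
  -- unit. This adjoint is multiplication by `conj (b i)`, so `conj (b i) = 0` and multiplication by
  -- `b i` vanishes, which is absurd.
  have hinv : ∀ i, ∃ j, m j i = e := by
    intro i
    by_contra! hne
    have h0 : LinearMap.adjoint (O'.mulLeft (b i)) (b e) = 0 := by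
      refine InnerProductSpace.ext_inner_left_basis b.toBasis fun j => ?_
      rw [b.coe_toBasis, LinearMap.adjoint_inner_right, DaggerSCFA.mulLeft_apply, hmul,
        inner_smul_left, b.inner_eq_zero (hcomm j i ▸ hne j), mul_zero, inner_zero_right]
    have h1 : O'.mul (O'.conj (b i) ⊗ₜ[ℂ] O'.unit 1) = 0 := by
      rw [hunit, TensorProduct.tmul_smul, map_smul, ← DaggerSCFA.mulLeft_apply,
        ← O'.adjoint_mulLeft, h0, smul_zero]
    rw [O'.mul_unit_apply] at h1
    have h2 : O'.mulLeft (b i) = 0 := by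
      rw [← LinearMap.adjoint_adjoint (O'.mulLeft (b i)), O'.adjoint_mulLeft, h1, map_zero,
        map_zero]
    exact (hb i).ne_zero (O'.eq_zero_of_mulLeft_eq_zero h2)
  choose inv hinv using hinv
  -- The unit of `O'` is `s • b e`, with `b e` a unit vector, and has squared norm the dimension.
  have hnorm : ‖s‖ = Real.sqrt (Fintype.card ι) := by
    have h1 := O'.inner_unit_one_self
    rw [hunit, inner_smul_left, inner_smul_right, (hb e).inner_self, mul_one,
      Complex.conj_mul', ← hι] at h1
    rw [← Real.sqrt_sq (norm_nonneg s)]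
    congr 1
    exact_mod_cast h1
  have hpos : (0 : ℝ) < Real.sqrt (Fintype.card ι) :=
    Real.sqrt_pos.mpr (Nat.cast_pos.mpr Fintype.card_pos)
  have hne : (Real.sqrt (Fintype.card ι) : ℂ) ≠ 0 := Complex.ofReal_ne_zero.mpr hpos.ne'
  obtain ⟨ω, hω⟩ := Circle.exists_coe_eq (z := s / Real.sqrt (Fintype.card ι)) (by
    rw [norm_div, hnorm, Complex.norm_real, Real.norm_of_nonneg hpos.le, div_self hpos.ne'])
  have hωs : (ω : ℂ) * (Real.sqrt (Fintype.card ι) : ℂ) = s := by rw [hω, div_mul_cancel₀ _ hne]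
  let inst : CommGroup ι :=
    { mul := m
      one := e
      inv := inv
      mul_assoc := hassoc
      one_mul := hone
      mul_one := fun i => (hcomm i e).trans (hone i)
      inv_mul_cancel := hinv
      mul_comm := hcomm }
  exact ⟨inst, b, ω, fun g => (hb g).1, fun g => (hb g).2, fun g k => by rw [hωs]; exact hmul g k,
    by rw [hωs]; exact hunit⟩

end StronglyComplementary

namespace HasGroupForm

variable {G K : Type*} [CommGroup G] [Fintype G] [CommGroup K] [Fintype K]
  {O O' P P' : DaggerSCFA H} {b : OrthonormalBasis G ℂ H} {c : OrthonormalBasis K ℂ H}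
  {ω ν : Circle}

theorem scalar_ne_zero (ω : Circle) (G : Type*) [Group G] [Fintype G] :
    (ω : ℂ) * (Real.sqrt (Fintype.card G) : ℂ) ≠ 0 :=
  mul_ne_zero ω.coe_ne_zero (Complex.ofReal_ne_zero.mpr
    (Real.sqrt_pos.mpr (Nat.cast_pos.mpr Fintype.card_pos)).ne')

theorem isClassical (h : HasGroupForm O O' b ω) (g : G) : O.IsClassical (b g) :=
  ⟨h.comul_basis g, h.counit_basis g⟩

theorem pairScalar_eq (h : HasGroupForm O O' b ω) :
    pairScalar O O' = (ω : ℂ) * (Real.sqrt (Fintype.card G) : ℂ) := by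
  rw [pairScalar, h.unit_one, map_smul, h.counit_basis, smul_eq_mul, mul_one]

theorem stronglyComplementary (h : HasGroupForm O O' b ω) : StronglyComplementary O O' := by
  have hz := scalar_ne_zero ω G
  refine ⟨?_, ?_, ?_⟩
  · rw [h.pairScalar_eq]
    refine TensorProduct.ext (b.toBasis.ext fun i => b.toBasis.ext fun j => ?_)
    simp [h.comul_basis, h.mul_basis, ← TensorProduct.smul_tmul', TensorProduct.tmul_smul,
      -mul_inv_rev, smul_smul, hz]
  · rw [h.pairScalar_eq]
    refine LinearMap.ext_ring ?_
    simp [h.comul_basis, h.unit_one, ← TensorProduct.smul_tmul', TensorProduct.tmul_smul]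
  · rw [h.pairScalar_eq]
    refine TensorProduct.ext (b.toBasis.ext fun i => b.toBasis.ext fun j => ?_)
    simp [h.counit_basis, h.mul_basis, -mul_inv_rev, hz]

theorem card_eq (_ : HasGroupForm O O' b ω) : Fintype.card G = Module.finrank ℂ H :=
  (Module.finrank_eq_card_basis b.toBasis).symm

/-- The group is determined by the pair. -/
theorem nonempty_mulEquiv (h : HasGroupForm O O' b ω) (k : HasGroupForm O O' c ν) :
    Nonempty (G ≃* K) := by
  have hz := h.pairScalar_eq.symm.trans k.pairScalar_eq
  have hb : Function.Injective b := by simpa using b.toBasis.injective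
  have hc : Function.Injective c := by simpa using c.toBasis.injective
  -- Both bases consist of all the classical vectors of `O`, so they differ by a relabelling `f`.
  -- The two scalars agree, being the pair scalar, so comparing products shows that `f` is
  -- multiplicative.
  choose f hf using fun g => (h.isClassical g).exists_eq k.isClassical
  have hinj : Function.Injective f := fun x y hxy => hb (by rw [hf, hf, hxy])
  have hbij : Function.Bijective f :=
    (Fintype.bijective_iff_injective_and_card f).mpr ⟨hinj, h.card_eq.trans k.card_eq.symm⟩
  refine ⟨MulEquiv.ofBijective (MulHom.mk f fun x y => hc ?_) hbij⟩
  refine smul_right_injective H (inv_ne_zero (scalar_ne_zero ν K)) ?_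
  change _ • c (f (x * y)) = _ • c (f x * f y)
  rw [← hf, ← k.mul_basis, ← hf, ← hf, h.mul_basis, hz]

/-- The form is transported along a unitary which carries one pair to another. -/
theorem map (h : HasGroupForm O O' b ω) {U : H ≃ₗᵢ[ℂ] H} (hU : Carries U 1 O P)
    (hU' : Carries U ν O' P') : HasGroupForm P P' (b.map U) (ω * ν⁻¹) := by
  have hν : (ν : ℂ) ≠ 0 := ν.coe_ne_zero
  refine ⟨fun g => ?_, fun g => ?_, fun g k => ?_, ?_⟩
  · simpa [h.comul_basis] using (LinearMap.congr_fun hU.comul_eq (b g)).symm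
  · simpa [h.counit_basis] using (LinearMap.congr_fun hU.counit_eq (b g)).symm
  · have := LinearMap.congr_fun hU'.mul_eq (b g ⊗ₜ[ℂ] b k)
    simp only [LinearMap.comp_apply, h.mul_basis, map_smul, LinearMap.smul_apply,
      TensorProduct.map_tmul, Circle.coe_inv] at this
    rw [← inv_smul_eq_iff₀ (inv_ne_zero hν), smul_smul] at this
    refine this.symm.trans ?_
    congr 1
    rw [Circle.coe_mul, Circle.coe_inv]
    simp only [mul_inv, inv_inv]
    ring
  · have := LinearMap.congr_fun hU'.unit_eq 1
    simp only [LinearMap.comp_apply, h.unit_one, map_smul, LinearMap.smul_apply] at this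
    rw [← inv_smul_eq_iff₀ hν, smul_smul] at this
    refine this.symm.trans ?_
    congr 1
    rw [Circle.coe_mul, Circle.coe_inv]
    ring

theorem reindex (h : HasGroupForm O O' b ω) (e : G ≃* K) :
    HasGroupForm O O' (b.reindex e.toEquiv) ω := by
  have hc : Fintype.card G = Fintype.card K := Fintype.card_congr e.toEquiv
  refine ⟨fun g => ?_, fun g => ?_, fun g k => ?_, ?_⟩
  · simpa using h.comul_basis _
  · simpa using h.counit_basis _
  · simpa [hc] using h.mul_basis (e.symm g) (e.symm k)
  · simpa [hc] using h.unit_one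

/-- Pairs with isomorphic groups are isomorphic up to the relative phase. -/
theorem exists_carries (h : HasGroupForm O O' b ω) (k : HasGroupForm P P' c ν) (e : G ≃* K) :
    ∃ U : H ≃ₗᵢ[ℂ] H, Carries U 1 O P ∧ Carries U (ω * ν⁻¹) O' P' := by
  have hν : (ν : ℂ) ≠ 0 := ν.coe_ne_zero
  have hc : Fintype.card G = Fintype.card K := Fintype.card_congr e.toEquiv
  -- The unitary sends `b g` to `c (e g)`. The form prescribes the comonoid of `O` and the monoid of
  -- `O'`, so these halves are compared.
  refine ⟨b.equiv c e.toEquiv, .of_comul_counit ?_ ?_, .of_mul_unit ?_ ?_⟩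
  · refine b.toBasis.ext fun g => ?_
    simp [h.comul_basis, k.comul_basis]
  · refine b.toBasis.ext fun g => ?_
    simp [h.counit_basis, k.counit_basis]
  · refine TensorProduct.ext (b.toBasis.ext fun i => b.toBasis.ext fun j => ?_)
    simp [h.mul_basis, k.mul_basis, hc, smul_smul, -mul_inv_rev]
    congr 1
    field_simp
  · refine LinearMap.ext_ring ?_
    simp [h.unit_one, k.unit_one, hc, smul_smul]
    congr 1
    field_simp

end HasGroupForm
end GroupForm

/-! ### Construction of the two algebras from a basis -/

section TensorAdjoint

variable {H : Type*} [NormedAddCommGroup H] [InnerProductSpace ℂ H]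

theorem ext_basis_three {ι M : Type*} [AddCommMonoid M] [Module ℂ M] [Fintype ι]
    (b : OrthonormalBasis ι ℂ H) {f g : (H ⊗[ℂ] H) ⊗[ℂ] H →ₗ[ℂ] M}
    (h : ∀ i j k, f ((b i ⊗ₜ[ℂ] b j) ⊗ₜ[ℂ] b k) = g ((b i ⊗ₜ[ℂ] b j) ⊗ₜ[ℂ] b k)) : f = g :=
  TensorProduct.ext (TensorProduct.ext (b.toBasis.ext fun i => b.toBasis.ext fun j =>
    b.toBasis.ext fun k => by simpa using h i j k))

theorem ext_basis_two {ι M : Type*} [AddCommMonoid M] [Module ℂ M] [Fintype ι]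
    (b : OrthonormalBasis ι ℂ H) {f g : H ⊗[ℂ] H →ₗ[ℂ] M}
    (h : ∀ i j, f (b i ⊗ₜ[ℂ] b j) = g (b i ⊗ₜ[ℂ] b j)) : f = g :=
  TensorProduct.ext (b.toBasis.ext fun i => b.toBasis.ext fun j => by simpa using h i j)

/-- The bilinear map with prescribed values on a basis. -/
noncomputable def basisMul {ι : Type*} [Fintype ι] (b : OrthonormalBasis ι ℂ H) (f : ι → ι → H) :
    H ⊗[ℂ] H →ₗ[ℂ] H :=
  (b.toBasis.tensorProduct b.toBasis).constr ℂ fun p => f p.1 p.2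

theorem basisMul_apply {ι : Type*} [Fintype ι] (b : OrthonormalBasis ι ℂ H) (f : ι → ι → H)
    (i j : ι) : basisMul b f (b i ⊗ₜ[ℂ] b j) = f i j := by
  have := (b.toBasis.tensorProduct b.toBasis).constr_basis ℂ (fun p => f p.1 p.2) (i, j)
  rwa [Module.Basis.tensorProduct_apply, b.coe_toBasis] at this

variable [FiniteDimensional ℂ H]

theorem TensorProduct.adjoint_lid : LinearMap.adjoint (TensorProduct.lid ℂ H).toLinearMap =
    (TensorProduct.lid ℂ H).symm.toLinearMap := by
  rw [← TensorProduct.toLinearEquiv_lidIsometry]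
  exact LinearIsometryEquiv.adjoint_toLinearMap_eq_symm _

theorem TensorProduct.adjoint_rid : LinearMap.adjoint (TensorProduct.rid ℂ H).toLinearMap =
    (TensorProduct.rid ℂ H).symm.toLinearMap := by
  rw [← TensorProduct.toLinearEquiv_ridIsometry]
  exact LinearIsometryEquiv.adjoint_toLinearMap_eq_symm _

end TensorAdjoint

namespace DaggerSCFA

variable {H : Type*} [NormedAddCommGroup H] [InnerProductSpace ℂ H] [FiniteDimensional ℂ H]

/-- A `†`-SCFA from its monoid; the comonoid laws follow by taking adjoints. -/
noncomputable def ofMonoid (mul : H ⊗[ℂ] H →ₗ[ℂ] H) (unit : ℂ →ₗ[ℂ] H)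
    (mul_assoc : mul ∘ₗ mul.rTensor H =
      mul ∘ₗ mul.lTensor H ∘ₗ (TensorProduct.assoc ℂ H H H).toLinearMap)
    (unit_mul : mul ∘ₗ unit.rTensor H = (TensorProduct.lid ℂ H).toLinearMap)
    (mul_comm : mul ∘ₗ (TensorProduct.comm ℂ H H).toLinearMap = mul)
    (frobenius : mul.rTensor H ∘ₗ (TensorProduct.assoc ℂ H H H).symm.toLinearMap ∘ₗ
      (LinearMap.adjoint mul).lTensor H = LinearMap.adjoint mul ∘ₗ mul)
    (special : mul ∘ₗ LinearMap.adjoint mul = LinearMap.id) : DaggerSCFA H :=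
  have mul_unit : mul ∘ₗ unit.lTensor H = (TensorProduct.rid ℂ H).toLinearMap := by
    refine TensorProduct.ext' fun x z => ?_
    have h1 := LinearMap.congr_fun mul_comm (unit z ⊗ₜ[ℂ] x)
    have h2 := LinearMap.congr_fun unit_mul (z ⊗ₜ[ℂ] x)
    simp at h1 h2 ⊢
    rw [h1, h2]
  { mul := mul
    unit := unit
    comul := LinearMap.adjoint mul
    counit := LinearMap.adjoint unit
    mul_assoc := mul_assoc
    unit_mul := unit_mul
    mul_unit := mul_unit
    comul_coassoc := by
      -- The associator is unitary, so coassociativity is the adjoint of associativity with the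
      -- associator moved across.
      rw [← LinearMap.adjoint_lTensor, ← LinearMap.adjoint_rTensor,
        ← TensorProduct.toLinearEquiv_assocIsometry,
        ← (TensorProduct.assocIsometry ℂ _ _ _).symm_symm,
        ← LinearIsometryEquiv.adjoint_toLinearMap_eq_symm]
      simp_rw [← LinearMap.adjoint_comp]
      congr 1
      refine LinearMap.ext fun t => ?_
      simpa using LinearMap.congr_fun mul_assoc ((TensorProduct.assoc ℂ H H H).symm t)
    counit_comul := by
      have := congrArg LinearMap.adjoint unit_mul
      simpa only [LinearMap.adjoint_comp, LinearMap.adjoint_rTensor, TensorProduct.adjoint_lid] using this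
    comul_counit := by
      have := congrArg LinearMap.adjoint mul_unit
      simpa only [LinearMap.adjoint_comp, LinearMap.adjoint_lTensor, TensorProduct.adjoint_rid] using this
    frobenius_left := frobenius
    frobenius_right := by
      -- The right Frobenius law is the adjoint of the left one, as `δ μ` is self-adjoint.
      have h1 : mul.lTensor H = LinearMap.adjoint ((LinearMap.adjoint mul).lTensor H) := by
        rw [LinearMap.adjoint_lTensor, LinearMap.adjoint_adjoint]
      have h2 : LinearMap.adjoint mul ∘ₗ mul = LinearMap.adjoint (LinearMap.adjoint mul ∘ₗ mul) := by
        rw [LinearMap.adjoint_comp, LinearMap.adjoint_adjoint]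
      rw [h1, h2, ← LinearMap.adjoint_rTensor,
        ← TensorProduct.toLinearEquiv_assocIsometry,
        ← (TensorProduct.assocIsometry ℂ _ _ _).symm_symm,
        ← LinearIsometryEquiv.adjoint_toLinearMap_eq_symm]
      simp_rw [← LinearMap.adjoint_comp]
      congr 1
    mul_eq_adjoint := (LinearMap.adjoint_adjoint mul).symm
    unit_eq_adjoint := (LinearMap.adjoint_adjoint unit).symm
    mul_comm := mul_comm
    special := special }

theorem adjoint_basisMul {ι : Type*} [Fintype ι] (b : OrthonormalBasis ι ℂ H) (f : ι → ι → H)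
    (x : H) : LinearMap.adjoint (basisMul b f) x =
      ∑ i, ∑ j, inner ℂ (f i j) x • (b i ⊗ₜ[ℂ] b j) := by
  rw [← (b.tensorProduct b).sum_repr' (LinearMap.adjoint (basisMul b f) x), Fintype.sum_prod_type]
  simp [LinearMap.adjoint_inner_right, basisMul_apply]

/-- The `†`-SCFA which copies and deletes an orthonormal basis. -/
theorem exists_comul_basis {ι : Type*} [Fintype ι] (b : OrthonormalBasis ι ℂ H) :
    ∃ O : DaggerSCFA H, (∀ i, O.comul (b i) = b i ⊗ₜ[ℂ] b i) ∧ ∀ i, O.counit (b i) = 1 := by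
  classical
  let m := basisMul b fun i j => if i = j then b i else 0
  have hm : ∀ i j, m (b i ⊗ₜ[ℂ] b j) = if i = j then b i else 0 := basisMul_apply b _
  have ha : ∀ i, LinearMap.adjoint m (b i) = b i ⊗ₜ[ℂ] b i := fun i => by
    rw [adjoint_basisMul]
    simp [apply_ite (fun x => inner ℂ x (b i)), b.inner_eq_ite]
  let η := LinearMap.toSpanSingleton ℂ H (∑ i, b i)
  refine ⟨ofMonoid m η ?_ ?_ ?_ ?_ ?_, ha, fun i => ?_⟩
  · refine ext_basis_three b fun i j k => ?_
    simp [hm]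
    split_ifs <;> simp_all
  · refine TensorProduct.ext (LinearMap.ext_ring (b.toBasis.ext fun i => ?_))
    simp [η, TensorProduct.sum_tmul, hm]
  · refine ext_basis_two b fun i j => ?_
    simp [hm]
    split_ifs <;> simp_all
  · refine ext_basis_two b fun i j => ?_
    simp [hm, ha]
    split_ifs <;> simp_all
  · refine b.toBasis.ext fun i => ?_
    simp [hm, ha]
  · change LinearMap.adjoint η (b i) = 1
    have := LinearMap.adjoint_inner_right η 1 (b i)
    simpa [η, sum_inner, b.inner_eq_ite] using this

/-- The group algebra with respect to an orthonormal basis, rescaled so as to be special. -/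
theorem exists_mul_basis {G : Type*} [CommGroup G] [Fintype G] (b : OrthonormalBasis G ℂ H)
    {z : ℂ} (hz : ‖z‖ ^ 2 = Fintype.card G) :
    ∃ O : DaggerSCFA H, (∀ g h, O.mul (b g ⊗ₜ[ℂ] b h) = z⁻¹ • b (g * h)) ∧
      O.unit 1 = z • b 1 := by
  classical
  have hzz : (starRingEnd ℂ) z * z = Fintype.card G := by
    rw [Complex.conj_mul']; exact_mod_cast hz
  have hz0 : z ≠ 0 := by rintro rfl; simp [eq_comm] at hz
  let m := basisMul b fun g h => z⁻¹ • b (g * h)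
  have hm : ∀ g h, m (b g ⊗ₜ[ℂ] b h) = z⁻¹ • b (g * h) := basisMul_apply b _
  have ha : ∀ g, LinearMap.adjoint m (b g) =
      ((starRingEnd ℂ) z)⁻¹ • ∑ h, b h ⊗ₜ[ℂ] b (h⁻¹ * g) := fun g => by
    rw [adjoint_basisMul, Finset.smul_sum]
    refine Finset.sum_congr rfl fun h _ => ?_
    rw [Finset.sum_eq_single (h⁻¹ * g)]
    · simp
    · intro k _ hk
      rw [inner_smul_left, b.inner_eq_zero, mul_zero, zero_smul]
      rintro rfl
      simp at hk
    · simp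
  refine ⟨ofMonoid m (LinearMap.toSpanSingleton ℂ H (z • b 1)) ?_ ?_ ?_ ?_ ?_, hm, ?_⟩
  · refine ext_basis_three b fun i j k => ?_
    simp [hm, ← TensorProduct.smul_tmul', mul_assoc]
  · refine TensorProduct.ext (LinearMap.ext_ring (b.toBasis.ext fun i => ?_))
    simp [hm, ← TensorProduct.smul_tmul', hz0]
  · refine ext_basis_two b fun i j => ?_
    simp [hm, _root_.mul_comm]
  · refine ext_basis_two b fun i j => ?_
    simp [hm, ha, TensorProduct.tmul_sum, ← TensorProduct.smul_tmul']
    rw [← Finset.smul_sum, smul_comm]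
    congr 2
    -- The sum over factorisations of `i * j` is reindexed by left translation.
    refine Fintype.sum_equiv (Equiv.mulLeft i) _ _ fun x => ?_
    simp [mul_assoc]
  · refine b.toBasis.ext fun i => ?_
    simp [hm, ha]
    -- Each of the `|G|` factorisations of `i` contributes equally, and `|G| = z̄ z` cancels the two
    -- scalars: this fixes the modulus of `z`.
    rw [← Nat.cast_smul_eq_nsmul ℂ, smul_smul, ← hzz]
    have : (starRingEnd ℂ) z ≠ 0 := by simpa using hz0
    rw [inv_mul_cancel_left₀ this, smul_inv_smul₀ hz0]
  · change LinearMap.toSpanSingleton ℂ H (z • b 1) 1 = _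
    simp

end DaggerSCFA

/-! ### Bijections of isomorphism classes -/

section Classification

/-- A relation which is total on both sides and matches two equivalence relations induces a
bijection of the quotients. -/
theorem exists_quotient_equiv {α β : Type*} (r : Setoid α) (s : Setoid β) (R : α → β → Prop)
    (hl : ∀ a, ∃ b, R a b) (hr : ∀ b, ∃ a, R a b)
    (hrs : ∀ {a a' b b'}, R a b → R a' b' → (r a a' ↔ s b b'))
    (hR : ∀ {a b b'}, R a b → s b b' → R a b') :
    ∃ Φ : Quotient r ≃ Quotient s, ∀ a b, Φ (Quotient.mk r a) = Quotient.mk s b ↔ R a b := by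
  choose f hf using hl
  let F : Quotient r → Quotient s := Quotient.map f fun a a' h => (hrs (hf a) (hf a')).mp h
  have hF : ∀ a b, F (Quotient.mk r a) = Quotient.mk s b ↔ R a b := fun a b =>
    ⟨fun h => hR (hf a) (Quotient.exact h),
      fun h => Quotient.sound ((hrs (hf a) h).mp (r.refl a))⟩
  refine ⟨Equiv.ofBijective F ⟨?_, ?_⟩, hF⟩
  · rintro ⟨a⟩ ⟨a'⟩ h
    exact Quotient.sound ((hrs (hf a) (hf a')).mpr (Quotient.exact h))
  · rintro ⟨b⟩
    obtain ⟨a, ha⟩ := hr b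
    exact ⟨Quotient.mk r a, (hF a b).mpr ha⟩

variable {H : Type u} [NormedAddCommGroup H] [InnerProductSpace ℂ H] [FiniteDimensional ℂ H]

theorem existsUnique_hasGroupForm {G : Type*} [CommGroup G] [Fintype G]
    (b : OrthonormalBasis G ℂ H) (ω : Circle) :
    ∃! p : DaggerSCFA H × DaggerSCFA H, HasGroupForm p.1 p.2 b ω := by
  obtain ⟨O, h1, h2⟩ := DaggerSCFA.exists_comul_basis b
  obtain ⟨O', h3, h4⟩ := DaggerSCFA.exists_mul_basis b
    (z := (ω : ℂ) * (Real.sqrt (Fintype.card G) : ℂ)) (by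
      rw [norm_mul, Circle.norm_coe, one_mul, Complex.norm_real, Real.norm_of_nonneg
        (Real.sqrt_nonneg _), Real.sq_sqrt (Nat.cast_nonneg _)])
  refine ⟨(O, O'), ⟨h1, h2, h3, h4⟩, ?_⟩
  rintro ⟨P, P'⟩ ⟨k1, k2, k3, k4⟩
  refine Prod.ext (DaggerSCFA.ext_of_comul_counit ?_ ?_) (DaggerSCFA.ext_of_mul_unit ?_ ?_)
  · exact b.toBasis.ext fun i => by simp [h1, k1]
  · exact b.toBasis.ext fun i => by simp [h2, k2]
  · exact ext_basis_two b fun i j => by rw [h3, k3]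
  · exact LinearMap.ext_ring (by rw [h4, k4])

theorem StronglyComplementary.exists_hasGroupForm_type {O O' : DaggerSCFA H}
    (h : StronglyComplementary O O') (hH : 1 ≤ Module.finrank ℂ H) :
    ∃ (G : Type v) (_ : CommGroup G) (_ : Fintype G) (b : OrthonormalBasis G ℂ H) (ω : Circle),
      HasGroupForm O O' b ω := by
  -- Any index type of the right cardinality can carry the group; the lift of `Fin` places it in the
  -- universe `v`.
  have : Nonempty (ULift.{v} (Fin (Module.finrank ℂ H))) := ⟨⟨⟨0, hH⟩⟩⟩
  obtain ⟨i, b, ω, hf⟩ := h.exists_hasGroupForm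
    (ι := ULift.{v} (Fin (Module.finrank ℂ H))) (by simp)
  exact ⟨_, i, _, b, ω, hf⟩

theorem HasGroupForm.pairScalar_eq_sqrt_iff {G : Type*} [CommGroup G] [Fintype G]
    {O O' : DaggerSCFA H} {b : OrthonormalBasis G ℂ H} {ω : Circle} (h : HasGroupForm O O' b ω) :
    pairScalar O O' = (Real.sqrt (Module.finrank ℂ H) : ℂ) ↔ ω = 1 := by
  rw [h.pairScalar_eq, ← h.card_eq, mul_eq_right₀ (right_ne_zero_of_mul (scalar_ne_zero 1 G)),
    Circle.coe_eq_one]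

theorem exists_hasGroupForm_of_card {G : Type*} [CommGroup G] (ω : Circle)
    (hG : Nat.card G = Module.finrank ℂ H) (hH : 1 ≤ Module.finrank ℂ H) :
    ∃ (_ : Fintype G) (b : OrthonormalBasis G ℂ H) (O O' : DaggerSCFA H),
      HasGroupForm O O' b ω := by
  have : Finite G := Nat.finite_of_card_ne_zero (by omega)
  have inst := Fintype.ofFinite G
  let b : OrthonormalBasis G ℂ H := (stdOrthonormalBasis ℂ H).reindex
    (Fintype.equivOfCardEq (by rw [Fintype.card_fin, ← hG, Nat.card_eq_fintype_card]))
  obtain ⟨p, hp, -⟩ := existsUnique_hasGroupForm b ω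
  exact ⟨inst, b, p.1, p.2, hp⟩

theorem exists_equiv_pairIso (hH : 1 ≤ Module.finrank ℂ H) :
    ∃ Φ : Quotient (pairIso H) ≃ Quotient (groupIso.{v} (Module.finrank ℂ H)),
      ∀ (p : NormalisedSCPair H) (G : AbGroupOfOrder.{v} (Module.finrank ℂ H)),
        Φ (Quotient.mk _ p) = Quotient.mk _ G ↔
          ∃ (_ : Fintype G.1) (b : OrthonormalBasis G.1 ℂ H), HasGroupForm p.1.1 p.1.2 b 1 := by
  refine exists_quotient_equiv _ _ (fun (p : NormalisedSCPair H)
    (G : AbGroupOfOrder.{v} (Module.finrank ℂ H)) =>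
    ∃ (_ : Fintype G.1) (b : OrthonormalBasis G.1 ℂ H), HasGroupForm p.1.1 p.1.2 b 1) ?_ ?_ ?_ ?_
  · rintro ⟨p, hp, hs⟩
    obtain ⟨G, _, _, b, ω, hf⟩ := hp.exists_hasGroupForm_type hH
    obtain rfl := hf.pairScalar_eq_sqrt_iff.mp hs
    exact ⟨⟨CommGrpCat.of G, by rw [← hf.card_eq, ← Nat.card_eq_fintype_card]⟩, ‹_›, b, hf⟩
  · rintro ⟨G, hG⟩
    obtain ⟨i, b, O, O', hf⟩ := exists_hasGroupForm_of_card 1 hG hH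
    exact ⟨⟨(O, O'), hf.stronglyComplementary, hf.pairScalar_eq_sqrt_iff.mpr rfl⟩, i, b, hf⟩
  · rintro p q G K ⟨_, b, hf⟩ ⟨_, c, hk⟩
    constructor
    · rintro ⟨U, h, k⟩
      -- Transport along `U` gives the second pair two group forms, whose groups must be isomorphic.
      exact (hf.map h k).nonempty_mulEquiv hk
    · rintro ⟨e⟩
      obtain ⟨U, h, k⟩ := hf.exists_carries hk e
      exact ⟨U, h, by simpa using k⟩
  · rintro p G K ⟨_, b, hf⟩ ⟨e⟩
    let _ := Fintype.ofEquiv _ e.toEquiv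
    exact ⟨inferInstance, _, hf.reindex e⟩

theorem exists_equiv_pairPhaseIso (hH : 1 ≤ Module.finrank ℂ H) :
    ∃ Ψ : Quotient (pairPhaseIso H) ≃ Quotient (groupIso.{v} (Module.finrank ℂ H)),
      ∀ (p : SCPair H) (G : AbGroupOfOrder.{v} (Module.finrank ℂ H)),
        Ψ (Quotient.mk _ p) = Quotient.mk _ G ↔
          ∃ (_ : Fintype G.1) (b : OrthonormalBasis G.1 ℂ H) (ω : Circle),
            HasGroupForm p.1.1 p.1.2 b ω := by
  refine exists_quotient_equiv _ _ (fun (p : SCPair H)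
    (G : AbGroupOfOrder.{v} (Module.finrank ℂ H)) =>
    ∃ (_ : Fintype G.1) (b : OrthonormalBasis G.1 ℂ H) (ω : Circle),
      HasGroupForm p.1.1 p.1.2 b ω) ?_ ?_ ?_ ?_
  · rintro ⟨p, hp⟩
    obtain ⟨G, _, _, b, ω, hf⟩ := hp.exists_hasGroupForm_type hH
    exact ⟨⟨CommGrpCat.of G, by rw [← hf.card_eq, ← Nat.card_eq_fintype_card]⟩, ‹_›, b, ω, hf⟩
  · rintro ⟨G, hG⟩
    obtain ⟨i, b, O, O', hf⟩ := exists_hasGroupForm_of_card 1 hG hH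
    exact ⟨⟨(O, O'), hf.stronglyComplementary⟩, i, b, 1, hf⟩
  · rintro p q G K ⟨_, b, ω, hf⟩ ⟨_, c, ν, hk⟩
    constructor
    · rintro ⟨U, τ, h, k⟩
      exact (hf.map h k).nonempty_mulEquiv hk
    · rintro ⟨e⟩
      obtain ⟨U, h, k⟩ := hf.exists_carries hk e
      exact ⟨U, _, h, k⟩
  · rintro p G K ⟨_, b, ω, hf⟩ ⟨e⟩
    let _ := Fintype.ofEquiv _ e.toEquiv
    exact ⟨inferInstance, _, ω, hf.reindex e⟩

end Classification

theorem mainTheorem4 {H : Type u} [NormedAddCommGroup H] [InnerProductSpace ℂ H]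
    [FiniteDimensional ℂ H] (D : ℕ) (hD : 1 ≤ D) (hH : Module.finrank ℂ H = D) :
    -- the normalised strongly complementary pairs are exactly the pairs of group form
    (∀ O O' : DaggerSCFA H,
      (StronglyComplementary O O' ∧ pairScalar O O' = (Real.sqrt D : ℂ)) ↔
        ∃ (G : Type v) (_ : CommGroup G) (_ : Fintype G) (b : OrthonormalBasis G ℂ H),
          Fintype.card G = D ∧ HasGroupForm O O' b 1) ∧
    -- all strongly complementary pairs: the same up to a global phase
    (∀ O O' : DaggerSCFA H,
      StronglyComplementary O O' ↔
        ∃ (G : Type v) (_ : CommGroup G) (_ : Fintype G) (b : OrthonormalBasis G ℂ H)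
          (ω : Circle), Fintype.card G = D ∧ HasGroupForm O O' b ω) ∧
    -- every group, basis and phase occurs, for exactly one pair
    (∀ (G : Type v) [CommGroup G] [Fintype G] (b : OrthonormalBasis G ℂ H) (ω : Circle),
      ∃! p : DaggerSCFA H × DaggerSCFA H, HasGroupForm p.1 p.2 b ω) ∧
    -- isomorphism classes of normalised pairs and of groups of order `D` correspond 1-to-1
    (∃ Φ : Quotient (pairIso H) ≃ Quotient (groupIso.{v} D),
      ∀ (p : NormalisedSCPair H) (G : AbGroupOfOrder.{v} D),
        Φ (Quotient.mk _ p) = Quotient.mk _ G ↔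
          ∃ (_ : Fintype G.1) (b : OrthonormalBasis G.1 ℂ H), HasGroupForm p.1.1 p.1.2 b 1) ∧
    -- the same for all strongly complementary pairs, up to isomorphism and phase
    (∃ Ψ : Quotient (pairPhaseIso H) ≃ Quotient (groupIso.{v} D),
      ∀ (p : SCPair H) (G : AbGroupOfOrder.{v} D),
        Ψ (Quotient.mk _ p) = Quotient.mk _ G ↔
          ∃ (_ : Fintype G.1) (b : OrthonormalBasis G.1 ℂ H) (ω : Circle),
            HasGroupForm p.1.1 p.1.2 b ω) := by
  subst hH
  refine ⟨fun O O' => ⟨?_, ?_⟩, fun O O' => ⟨fun h => ?_, ?_⟩, fun G _ _ b ω =>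
    existsUnique_hasGroupForm b ω, exists_equiv_pairIso hD, exists_equiv_pairPhaseIso hD⟩
  · rintro ⟨h, hs⟩
    obtain ⟨G, i, j, b, ω, hf⟩ := h.exists_hasGroupForm_type hD
    obtain rfl := hf.pairScalar_eq_sqrt_iff.mp hs
    exact ⟨G, i, j, b, hf.card_eq, hf⟩
  · rintro ⟨G, _, _, b, -, hf⟩
    exact ⟨hf.stronglyComplementary, hf.pairScalar_eq_sqrt_iff.mpr rfl⟩
  · obtain ⟨G, i, j, b, ω, hf⟩ := h.exists_hasGroupForm_type hD
    exact ⟨G, i, j, b, ω, hf.card_eq, hf⟩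
  · rintro ⟨G, _, _, b, ω, -, hf⟩
    exact hf.stronglyComplementary
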